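/- Let $r\ge 1$. A solution of the $A_r$ $Q$-system in a field $K$ is a family $R_{\alpha,n}\in K$ ($0\le\alpha\le r+1$, $n\in\mathbb Z$) with $R_{0,n}=R_{r+1,n}=1$ and $$R_{\alpha,n+1}R_{\alpha,n-1}=R_{\alpha,n}^2+R_{\alpha+1,n}R_{\alpha-1,n}\qquad(1\le\alpha\le r,\ n\in\mathbb Z).$$ (a) In the field of rational functions over $\mathbb Q$ in $2r$ independent variables there is a solution whose seed $\mathbf x_0=(R_{\alpha,0},R_{\alpha,1})_{1\le\alpha\le r}$ consists of these variables, and every such solution satisfies $R_{\alpha,n}\ne0$ for all $1\le\alpha\le r$, $n\in\mathbb Z$. (b) Let $K$ be any field and $R$ a solution of the $A_r$ $Q$-system in $K$ with $R_{\alpha,n}\neq 0$ for all $1\le\alpha\le r$ and $n\ge0$ (for instance a solution as in (a)). Put $$y_{2\alpha-1}=\frac{R_{\alpha-1,0}R_{\alpha,1}}{R_{\alpha,0}R_{\alpha-1,1}}\ (1\le\alpha\le r+1),\qquad y_{2\alpha}=\frac{R_{\alpha-1,0}R_{\alpha+1,1}}{R_{\alpha,0}R_{\alpha,1}}\ (1\le\alpha\le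 r),$$ and let $T'$ be the $(r+1)\times(r+1)$ tridiagonal matrix over $K[[t]]$ with diagonal entries $T'_{i,i}=ty_{2i-1}$, upper diagonal entries $T'_{i,i+1}=ty_{2i}$ and lower diagonal entries $T'_{i+1,i}=1$. Then $I-T'$ is invertible over $K[[t]]$ and, in $K[[t]]$, $$\sum_{n\ge0}R_{1,n}t^n=R_{1,0}\left(1+t\,\cfrac{y_1}{1-ty_1-\cfrac{ty_2}{1-ty_3-\cfrac{ty_4}{\ddots\,\cfrac{\ }{1-ty_{2r-1}-\cfrac{ty_{2r}}{1-ty_{2r+1}}}}}}\right)=R_{1,0}\left(1+t\,\frac{R_{1,1}}{R_{1,0}}\big((I-T')^{-1}\big)_{1,1}\right).$$ Moreover, for all $n\ge0$, $$R_{1,n+1}=R_{1,1}\sum_{\substack{p_1,\dots,p_{2r+1}\ge0\\ p_1+\cdots+p_{2r+1}=n}}\ \prod_{i=1}^{r}\frac{(R_{i,0})^{p_{2i+2}+p_{2i+1}-p_{2i}-p_{2i-1}}}{(R_{i,1})^{p_{2i+1}+p_{2i}-p_{2i-1}-p_{2i-2}}}\ \binom{p_1+p_2}{p_1}\prod_{\ell=1}^{r}\binom{p_{2\ell}+p_{2\ell+1}+p_{2\ell+2}-1}{p_{2\ell}-1,\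 p_{2\ell+1}},$$ where $p_0=p_{2r+2}=0$. Here $\binom{N}{m_1,\dots,m_k}=\frac{N!}{m_1!\cdots m_k!\,(N-\sum m_i)!}$ if $\sum m_i\le N$ and $0$ otherwise, and $\binom{a+b+c-1}{a-1,\,b}$ for $a=0$ means $1$ if $b=c=0$ and $0$ otherwise. Thus $R_{1,n+1}$ is an explicit Laurent polynomial in the seed with nonnegative integer coefficients. -/

import Mathlib

/-- The multinomial coefficient `N! / (m₁! ⋯ m_k! (N - ∑ m_i)!)`, equal to `0` if `∑ m_i > N`. -/
def multinomialCoeff (N : ℕ) (m : List ℕ) : ℕ :=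
  if m.sum ≤ N then
    Nat.factorial N / ((m.map Nat.factorial).prod * Nat.factorial (N - m.sum))
  else 0

/-- The coefficient `(a+b+c-1 choose a-1, b)`. For `a = 0` the usual convention is in force:
it is `1` if `b = c = 0`, and `0` otherwise (so that in all cases it is the coefficient of
`u ^ b * v ^ c` in `(1 - u - v) ^ (-a)`). -/
def stepCoeff (a b c : ℕ) : ℕ :=
  if a = 0 then (if b = 0 ∧ c = 0 then 1 else 0)
  else multinomialCoeff (a + b + c - 1) [a - 1, b]

/-- `R α n` (`0 ≤ α ≤ r + 1`, `n ∈ ℤ`) is a solution of the `A_r` `Q`-system. The values of `R α`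
for `α > r + 1` play no role. -/
structure IsQSystem {K : Type*} [Field K] (r : ℕ) (R : ℕ → ℤ → K) : Prop where
  bot : ∀ n : ℤ, R 0 n = 1
  top : ∀ n : ℤ, R (r + 1) n = 1
  rel : ∀ α : ℕ, 1 ≤ α → α ≤ r → ∀ n : ℤ,
    R α (n + 1) * R α (n - 1) = R α n ^ 2 + R (α + 1) n * R (α - 1) n

/-- The weight `y_{2α-1}`, for `1 ≤ α ≤ r + 1`. -/
def yOdd {K : Type*} [Field K] (R : ℕ → ℤ → K) (α : ℕ) : K :=
  (R (α - 1) 0 * R α 1) / (R α 0 * R (α - 1) 1)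

/-- The weight `y_{2α}`, for `1 ≤ α ≤ r`. -/
def yEven {K : Type*} [Field K] (R : ℕ → ℤ → K) (α : ℕ) : K :=
  (R (α - 1) 0 * R (α + 1) 1) / (R α 0 * R α 1)

/-- The tridiagonal transfer matrix `T'` of size `r + 1`, with entries in `K[[t]]`: diagonal
`t y_1, t y_3, …, t y_{2r+1}`, upper diagonal `t y_2, t y_4, …, t y_{2r}`, lower diagonal `1`.
The index `i : Fin (r + 1)` stands for the vertex `i + 1`. -/
noncomputable def compactTransferMatrix {K : Type*} [Field K] (r : ℕ) (R : ℕ → ℤ → K) :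
    Matrix (Fin (r + 1)) (Fin (r + 1)) (PowerSeries K) :=
  fun i j =>
    if j.val = i.val then PowerSeries.X * PowerSeries.C (yOdd R (i.val + 1))
    else if j.val = i.val + 1 then PowerSeries.X * PowerSeries.C (yEven R (i.val + 1))
    else if i.val = j.val + 1 then 1
    else 0

/-- `contFrac R k α` is the finite continued fraction in `K[[t]]`
`1 / (1 - t y_{2α-1} - t y_{2α} / (1 - t y_{2α+1} - t y_{2α+2} / (⋯ / (1 - t y_{2(α+k)-1}))))`. -/
noncomputable def contFrac {K : Type*} [Field K] (R : ℕ → ℤ → K) : ℕ → ℕ → PowerSeries K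
  | 0, α => (1 - PowerSeries.X * PowerSeries.C (yOdd R α))⁻¹
  | k + 1, α =>
      (1 - PowerSeries.X * PowerSeries.C (yOdd R α)
        - PowerSeries.X * PowerSeries.C (yEven R α) * contFrac R k (α + 1))⁻¹

/-- The field of rational functions over `ℚ` in `2r` variables, indexed by `Fin r × Fin 2`. -/
abbrev SeedField (r : ℕ) : Type := FractionRing (MvPolynomial (Fin r × Fin 2) ℚ)

/-- `R` has the `2r` independent variables as its seed `(R_{α,0}, R_{α,1})`, `1 ≤ α ≤ r`. -/
def HasGenericSeed (r : ℕ) (R : ℕ → ℤ → SeedField r) : Prop :=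
  ∀ i : Fin r, ∀ e : Fin 2,
    R (i.val + 1) (e.val : ℤ) =
      algebraMap (MvPolynomial (Fin r × Fin 2) ℚ) (SeedField r) (MvPolynomial.X (i, e))

/-! Nonvanishing: subtraction-free recursions preserve the fractions `p / q` with `p` and `q`
positive at the point `(1, …, 1)`, so the `Q`-system can be run from the generic seed in both time
directions without dividing by zero.

Generating function: let `F` be the continued fraction of `R` and `F'` that of the solution shifted
by one time step. The `Q`-system relations give local identities between the weights at the two
times, and these combine, from the deepest level upward, into `F = 1 + t (R 1 2 / R 1 1) F'`
(`IsQSystem.contFrac_eq_shift`). Iterating the shift yields `coeff n F = R 1 (n + 1) / R 1 1`. The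
resolvent entry is the same fraction by elimination along the chain.

Explicit formula: expand `F` level by level with the negative binomial series. The exponent of
`y_{2α}` chosen at one level is the power of the continued fraction to expand at the next, which
produces the chain of `stepCoeff` factors. The weights then regroup into powers of the seed. -/

/-! ### Existence and nonvanishing for the generic seed. -/

section GenericSeed

/-- The fractions of polynomials that are positive at the point with all coordinates `1`. -/
def PositiveAtOne {σ : Type*} (x : FractionRing (MvPolynomial σ ℚ)) : Prop :=
  ∃ p q : MvPolynomial σ ℚ, 0 < MvPolynomial.eval (fun _ => 1) p ∧
    0 < MvPolynomial.eval (fun _ => 1) q ∧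
    x * algebraMap _ (FractionRing (MvPolynomial σ ℚ)) q = algebraMap _ _ p

namespace PositiveAtOne

variable {σ : Type*} {x y z : FractionRing (MvPolynomial σ ℚ)}

theorem one : PositiveAtOne (1 : FractionRing (MvPolynomial σ ℚ)) :=
  ⟨1, 1, by simp, by simp, by simp⟩

theorem of_variable (i : σ) : PositiveAtOne
    (algebraMap (MvPolynomial σ ℚ) (FractionRing (MvPolynomial σ ℚ)) (MvPolynomial.X i)) :=
  ⟨MvPolynomial.X i, 1, by simp, by simp, by simp⟩

theorem algebraMap_ne_zero {q : MvPolynomial σ ℚ}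
    (hq : 0 < MvPolynomial.eval (fun _ => 1) q) :
    algebraMap _ (FractionRing (MvPolynomial σ ℚ)) q ≠ 0 := by
  intro h
  rw [FaithfulSMul.algebraMap_eq_zero_iff] at h
  simp [h] at hq

theorem ne_zero (hx : PositiveAtOne x) : x ≠ 0 := by
  rintro rfl
  obtain ⟨p, q, hp, -, h⟩ := hx
  rw [zero_mul] at h
  exact algebraMap_ne_zero hp h.symm

theorem add (hx : PositiveAtOne x) (hy : PositiveAtOne y) : PositiveAtOne (x + y) := by
  obtain ⟨p, q, hp, hq, h⟩ := hx
  obtain ⟨p', q', hp', hq', h'⟩ := hy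
  refine ⟨p * q' + p' * q, q * q', ?_, ?_, ?_⟩
  · rw [map_add, map_mul, map_mul]; positivity
  · rw [map_mul]; positivity
  · rw [map_add, map_mul, map_mul, map_mul, ← h, ← h']; ring

theorem mul (hx : PositiveAtOne x) (hy : PositiveAtOne y) : PositiveAtOne (x * y) := by
  obtain ⟨p, q, hp, hq, h⟩ := hx
  obtain ⟨p', q', hp', hq', h'⟩ := hy
  refine ⟨p * p', q * q', ?_, ?_, ?_⟩
  · rw [map_mul]; positivity
  · rw [map_mul]; positivity
  · rw [map_mul, map_mul, ← h, ← h']; ring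

theorem of_mul_right (hy : PositiveAtOne y) (hz : PositiveAtOne (x * y)) : PositiveAtOne x := by
  have hy0 := hy.ne_zero
  obtain ⟨p, q, hp, hq, h⟩ := hy
  obtain ⟨p', q', hp', hq', h'⟩ := hz
  refine ⟨p' * q, p * q', ?_, ?_, ?_⟩
  · rw [map_mul]; positivity
  · rw [map_mul]; positivity
  · rw [map_mul, map_mul, ← h, ← h']; ring

end PositiveAtOne

/-- The recursion has three terms in time, so two consecutive times are carried together; one can
then step forward or backward by dividing by a known positive factor. -/
theorem IsQSystem.positiveAtOne {r : ℕ} {R : ℕ → ℤ → SeedField r} (hR : IsQSystem r R)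
    (hs : HasGenericSeed r R) (n : ℤ) :
    (∀ α ≤ r + 1, PositiveAtOne (R α n)) ∧ ∀ α ≤ r + 1, PositiveAtOne (R α (n + 1)) := by
  have ends : ∀ (m : ℤ), (∀ α, 1 ≤ α → α ≤ r → PositiveAtOne (R α m)) →
      ∀ α ≤ r + 1, PositiveAtOne (R α m) := by
    intro m h α hα
    rcases Nat.eq_zero_or_pos α with rfl | h0
    · rw [hR.bot]; exact .one
    rcases hα.eq_or_lt with rfl | h1
    · rw [hR.top]; exact .one
    · exact h α h0 (by omega)
  have rhs : ∀ (m : ℤ), (∀ α ≤ r + 1, PositiveAtOne (R α m)) → ∀ α, 1 ≤ α → α ≤ r →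
      PositiveAtOne (R α (m + 1) * R α (m - 1)) := by
    intro m h α h1 h2
    rw [hR.rel α h1 h2, sq]
    exact ((h α (by omega)).mul (h α (by omega))).add
      ((h (α + 1) (by omega)).mul (h (α - 1) (by omega)))
  induction n using Int.induction_on with
  | zero =>
    refine ⟨ends _ fun α h1 h2 => ?_, ends _ fun α h1 h2 => ?_⟩
    · have := hs ⟨α - 1, by omega⟩ 0
      simp only [Nat.sub_add_cancel h1, Fin.val_zero, Nat.cast_zero] at this
      rw [this]; exact .of_variable _
    · have := hs ⟨α - 1, by omega⟩ 1
      simp only [Nat.sub_add_cancel h1, Fin.val_one, Nat.cast_one] at this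
      rw [zero_add, this]; exact .of_variable _
  | succ i ih =>
    refine ⟨ih.2, ends _ fun α h1 h2 => ?_⟩
    have := rhs _ ih.2 α h1 h2
    rw [add_sub_cancel_right] at this
    exact (ih.1 α (by omega)).of_mul_right this
  | pred i ih =>
    rw [sub_add_cancel]
    refine ⟨ends _ fun α h1 h2 => ?_, ih.1⟩
    have := rhs _ ih.1 α h1 h2
    rw [mul_comm] at this
    exact (ih.2 α (by omega)).of_mul_right this

/-- The forward evolution of the `A_r` `Q`-system from the values `x`, `y` at the times
`0` and `1`. -/
noncomputable def qForward {K : Type*} [Field K] (r : ℕ) (x y : ℕ → K) : ℕ → ℕ → K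
  | 0 => x
  | 1 => y
  | n + 2 => fun α => if 1 ≤ α ∧ α ≤ r then
      (qForward r x y (n + 1) α ^ 2 +
        qForward r x y (n + 1) (α + 1) * qForward r x y (n + 1) (α - 1)) / qForward r x y n α
      else 1

theorem qForward_positiveAtOne {r : ℕ} {σ : Type*} {x y : ℕ → FractionRing (MvPolynomial σ ℚ)}
    (hx : ∀ α, PositiveAtOne (x α)) (hy : ∀ α, PositiveAtOne (y α)) (n : ℕ) :
    (∀ α, PositiveAtOne (qForward r x y n α)) ∧
      ∀ α, PositiveAtOne (qForward r x y (n + 1) α) := by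
  induction n with
  | zero => exact ⟨hx, hy⟩
  | succ n ih =>
    refine ⟨ih.2, fun α => ?_⟩
    rw [qForward]
    dsimp only
    split_ifs
    · refine (ih.1 α).of_mul_right ?_
      rw [div_mul_cancel₀ _ (ih.1 α).ne_zero, sq]
      exact ((ih.2 _).mul (ih.2 _)).add ((ih.2 _).mul (ih.2 _))
    · exact .one

theorem qForward_eq_one {K : Type*} [Field K] {r : ℕ} {x y : ℕ → K} {α : ℕ}
    (hα : ¬(1 ≤ α ∧ α ≤ r)) (hx : x α = 1) (hy : y α = 1) : ∀ n, qForward r x y n α = 1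
  | 0 => hx
  | 1 => hy
  | _ + 2 => if_neg hα

theorem exists_isQSystem_hasGenericSeed (r : ℕ) :
    ∃ R : ℕ → ℤ → SeedField r, IsQSystem r R ∧ HasGenericSeed r R := by
  let seed (e : Fin 2) (α : ℕ) : SeedField r :=
    if h : 1 ≤ α ∧ α ≤ r then
      algebraMap (MvPolynomial (Fin r × Fin 2) ℚ) _ (MvPolynomial.X (⟨α - 1, by omega⟩, e))
    else 1
  have seed_pos : ∀ e α, PositiveAtOne (seed e α) := by
    intro e α
    simp only [seed]
    split_ifs
    · exact .of_variable _
    · exact .one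
  have seed_one : ∀ e α, ¬(1 ≤ α ∧ α ≤ r) → seed e α = 1 := fun e α h => dif_neg h
  let f := qForward r (seed 0) (seed 1)
  -- The relation is invariant under `n ↦ 1 - n`, so negative times come from the forward evolution
  -- of the swapped seed.
  let g := qForward r (seed 1) (seed 0)
  have f_pos : ∀ n α, PositiveAtOne (f n α) :=
    fun n => (qForward_positiveAtOne (seed_pos 0) (seed_pos 1) n).1
  have g_pos : ∀ n α, PositiveAtOne (g n α) :=
    fun n => (qForward_positiveAtOne (seed_pos 1) (seed_pos 0) n).1
  let R (α : ℕ) (n : ℤ) : SeedField r := if 0 ≤ n then f n.toNat α else g (1 - n).toNat α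
  have hf : ∀ α (n : ℕ), R α n = f n α := fun α n => by simp [R]
  have hg : ∀ α (n : ℕ), R α (1 - n) = g n α := by
    intro α n
    match n with
    | 0 => simp [R, f, g, qForward]
    | 1 => simp [R, f, g, qForward]
    | n + 2 =>
      have h : ¬ (0 : ℤ) ≤ 1 - ((n + 2 : ℕ) : ℤ) := by push_cast; omega
      simp only [R, if_neg h]
      congr 1
      omega
  have ends : ∀ α, ¬(1 ≤ α ∧ α ≤ r) → ∀ n, R α n = 1 := by
    intro α h n
    simp only [R]
    split_ifs
    · exact qForward_eq_one h (seed_one _ _ h) (seed_one _ _ h) _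
    · exact qForward_eq_one h (seed_one _ _ h) (seed_one _ _ h) _
  refine ⟨R, ⟨ends 0 (by omega), ends (r + 1) (by omega), fun α h1 h2 n => ?_⟩, fun i e => ?_⟩
  · rcases lt_or_ge 0 n with hn | hn
    · obtain ⟨k, rfl⟩ : ∃ k : ℕ, n = ((k + 1 : ℕ) : ℤ) := ⟨(n - 1).toNat, by omega⟩
      have e1 : (((k + 1 : ℕ) : ℤ) + 1) = ((k + 2 : ℕ) : ℤ) := by push_cast; ring
      have e2 : (((k + 1 : ℕ) : ℤ) - 1) = ((k : ℕ) : ℤ) := by push_cast; ring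
      rw [e1, e2]
      simp only [hf]
      have : f (k + 2) α = _ := if_pos ⟨h1, h2⟩
      rw [this]
      exact div_mul_cancel₀ _ (f_pos k α).ne_zero
    · obtain ⟨k, rfl⟩ : ∃ k : ℕ, n = 1 - ((k + 1 : ℕ) : ℤ) := ⟨(-n).toNat, by omega⟩
      have e1 : (1 - ((k + 1 : ℕ) : ℤ) - 1) = 1 - ((k + 2 : ℕ) : ℤ) := by push_cast; ring
      have e2 : (1 - ((k + 1 : ℕ) : ℤ) + 1) = 1 - ((k : ℕ) : ℤ) := by push_cast; ring
      rw [e1, e2, mul_comm]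
      simp only [hg]
      have : g (k + 2) α = _ := if_pos ⟨h1, h2⟩
      rw [this]
      exact div_mul_cancel₀ _ (g_pos k α).ne_zero
  · rw [hf]
    have : f e.val = seed e := by fin_cases e <;> rfl
    rw [this]
    exact dif_pos ⟨by omega, by omega⟩

end GenericSeed

/-! ### Continued fraction: time shift and resolvent. -/

section ContinuedFraction

open PowerSeries

variable {K : Type*} [Field K]

/-- The part of the denominator of `contFrac R k α` that comes from the deeper levels,
divided by `t`. -/
noncomputable def contFracTail (R : ℕ → ℤ → K) : ℕ → ℕ → PowerSeries K
  | 0, _ => 0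
  | k + 1, α => C (yEven R α) * contFrac R k (α + 1)

theorem contFrac_mul_denom (R : ℕ → ℤ → K) (k α : ℕ) :
    contFrac R k α * (1 - X * (C (yOdd R α) + contFracTail R k α)) = 1 := by
  cases k with
  | zero =>
    rw [contFrac, contFracTail, add_zero]
    exact PowerSeries.inv_mul_cancel _ (by simp)
  | succ k =>
    rw [contFrac, contFracTail, mul_add, ← sub_sub, ← mul_assoc X]
    exact PowerSeries.inv_mul_cancel _ (by simp)

/-- One level of the passage from a continued fraction to the one at the next time. -/
theorem contFrac_level_rearrange {A : Type*} [CommRing A] {t a b b' c' s s' P B F F' : A}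
    (h1 : a + b = s) (h2 : b' + c' = s') (h3 : b * s' = s * b') (hP : P * (1 - t * B) = s')
    (hF : F * (1 - t * P) = 1) (hF' : F' * (1 - t * (c' + B)) = 1) :
    (a + b * F) * (1 - t * (b' * F')) = s := by
  -- This is the goal with denominators cleared. By `h2` and `hP` the second factor is `(1 - t * B)
  -- * (1 - t * P)`; `h3` with `h1` and `h2` gives `a * s' = s * c'`.
  have key : (a * (1 - t * P) + b) * ((1 - t * (c' + B)) - t * b') =
      s * (1 - t * P) * (1 - t * (c' + B)) := by
    subst h1 h2
    linear_combination t * b * hP + t * (1 - t * P) * h3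
  calc (a + b * F) * (1 - t * (b' * F'))
      = (a * (F * (1 - t * P)) + b * F) * (F' * (1 - t * (c' + B)) - t * (b' * F')) := by
        rw [hF, hF']; ring
    _ = F * F' * ((a * (1 - t * P) + b) * ((1 - t * (c' + B)) - t * b')) := by ring
    _ = s * (F * (1 - t * P)) * (F' * (1 - t * (c' + B))) := by rw [key]; ring
    _ = s := by rw [hF, hF']; ring

theorem IsQSystem.shift {r : ℕ} {R : ℕ → ℤ → K} (hR : IsQSystem r R) :
    IsQSystem r (fun α n => R α (n + 1)) where
  bot n := hR.bot _
  top n := hR.top _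
  rel α h1 h2 n := by
    have := hR.rel α h1 h2 (n + 1)
    rw [show n + 1 - 1 = n - 1 + 1 by ring] at this
    exact this

variable {r : ℕ} {R : ℕ → ℤ → K}

theorem IsQSystem.ne_zero (hR : IsQSystem r R)
    (h0 : ∀ α : ℕ, 1 ≤ α → α ≤ r → ∀ n : ℤ, 0 ≤ n → R α n ≠ 0) {α : ℕ} (hα : α ≤ r + 1)
    {n : ℤ} (hn : 0 ≤ n) : R α n ≠ 0 := by
  rcases Nat.eq_zero_or_pos α with rfl | h
  · rw [hR.bot]; exact one_ne_zero
  rcases hα.eq_or_lt with rfl | h'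
  · rw [hR.top]; exact one_ne_zero
  · exact h0 α h (by omega) n hn

/-- The common value of `y_{2α-1} + y_{2α}` at one time and `y_{2α-2} + y_{2α-1}` at the next. -/
noncomputable def levelSum (R : ℕ → ℤ → K) (α : ℕ) : K :=
  R (α - 1) 0 * R α 2 / (R α 1 * R (α - 1) 1)

theorem IsQSystem.yOdd_add_yEven (hR : IsQSystem r R)
    (h0 : ∀ α : ℕ, 1 ≤ α → α ≤ r → ∀ n : ℤ, 0 ≤ n → R α n ≠ 0) {α : ℕ} (h1 : 1 ≤ α)
    (h2 : α ≤ r) : yOdd R α + yEven R α = levelSum R α := by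
  have n1 := hR.ne_zero h0 (show α ≤ r + 1 by omega) (n := 0) (by norm_num)
  have n2 := hR.ne_zero h0 (show α ≤ r + 1 by omega) (n := 1) (by norm_num)
  have n3 := hR.ne_zero h0 (show α - 1 ≤ r + 1 by omega) (n := 1) (by norm_num)
  have h := hR.rel α h1 h2 1
  norm_num at h
  rw [yOdd, yEven, levelSum]
  field_simp
  linear_combination (-R (α - 1) 0) * h

theorem IsQSystem.yEven_add_yOdd_shift (hR : IsQSystem r R)
    (h0 : ∀ α : ℕ, 1 ≤ α → α ≤ r → ∀ n : ℤ, 0 ≤ n → R α n ≠ 0) {α : ℕ} (h1 : 1 ≤ α)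
    (h2 : α ≤ r) :
    yEven (fun α n => R α (n + 1)) α + yOdd (fun α n => R α (n + 1)) (α + 1) =
      levelSum R (α + 1) := by
  have n1 := hR.ne_zero h0 (show α ≤ r + 1 by omega) (n := 1) (by norm_num)
  have n2 := hR.ne_zero h0 (show α ≤ r + 1 by omega) (n := 2) (by norm_num)
  have n3 := hR.ne_zero h0 (show α + 1 ≤ r + 1 by omega) (n := 1) (by norm_num)
  have h := hR.rel α h1 h2 1
  norm_num at h
  simp only [yOdd, yEven, levelSum, Nat.add_sub_cancel, zero_add, one_add_one_eq_two]
  field_simp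
  linear_combination (-R (α + 1) 2) * h

theorem IsQSystem.yEven_mul_levelSum (hR : IsQSystem r R)
    (h0 : ∀ α : ℕ, 1 ≤ α → α ≤ r → ∀ n : ℤ, 0 ≤ n → R α n ≠ 0) {α : ℕ}
    (h2 : α ≤ r) :
    yEven R α * levelSum R (α + 1) = levelSum R α * yEven (fun α n => R α (n + 1)) α := by
  have n0 := hR.ne_zero h0 (show α ≤ r + 1 by omega) (n := 0) (by norm_num)
  have n1 := hR.ne_zero h0 (show α ≤ r + 1 by omega) (n := 1) (by norm_num)
  have n2 := hR.ne_zero h0 (show α ≤ r + 1 by omega) (n := 2) (by norm_num)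
  have n3 := hR.ne_zero h0 (show α + 1 ≤ r + 1 by omega) (n := 1) (by norm_num)
  have n4 := hR.ne_zero h0 (show α - 1 ≤ r + 1 by omega) (n := 1) (by norm_num)
  simp only [yEven, levelSum, Nat.add_sub_cancel, zero_add, one_add_one_eq_two]
  field_simp

/-- Induction from the last level `α = r + 1`, where both tails vanish and `R (r + 1) = 1` makes
`levelSum` equal to `yOdd`. -/
theorem IsQSystem.contFracTail_shift (hR : IsQSystem r R)
    (h0 : ∀ α : ℕ, 1 ≤ α → α ≤ r → ∀ n : ℤ, 0 ≤ n → R α n ≠ 0) (k : ℕ) :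
    ∀ α, 1 ≤ α → α + k = r + 1 →
      (C (yOdd R α) + contFracTail R k α) *
        (1 - X * contFracTail (fun α n => R α (n + 1)) k α) = C (levelSum R α) := by
  induction k with
  | zero =>
    rintro α h1 rfl
    simp [contFracTail, yOdd, levelSum, hR.top, add_zero]
  | succ k ih =>
    intro α h1 h2
    refine contFrac_level_rearrange (s' := C (levelSum R (α + 1))) ?_ ?_ ?_
      (ih (α + 1) (by omega) (by omega)) (contFrac_mul_denom _ _ _) (contFrac_mul_denom _ _ _)
    · rw [← map_add, hR.yOdd_add_yEven h0 h1 (by omega)]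
    · rw [← map_add, hR.yEven_add_yOdd_shift h0 h1 (by omega)]
    · rw [← map_mul, ← map_mul, hR.yEven_mul_levelSum h0 (by omega)]

theorem IsQSystem.contFrac_eq_shift (hR : IsQSystem r R)
    (h0 : ∀ α : ℕ, 1 ≤ α → α ≤ r → ∀ n : ℤ, 0 ≤ n → R α n ≠ 0) :
    contFrac R r 1 = 1 + X * C (R 1 2 / R 1 1) * contFrac (fun α n => R α (n + 1)) r 1 := by
  have h1 := contFrac_mul_denom R r 1
  have h2 := contFrac_mul_denom (fun α n => R α (n + 1)) r 1
  have h3 := hR.contFracTail_shift h0 r 1 le_rfl (add_comm _ _)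
  have e1 : levelSum R 1 = R 1 2 / R 1 1 := by simp [levelSum, hR.bot]
  have e2 : yOdd (fun α n => R α (n + 1)) 1 = R 1 2 / R 1 1 := by
    simp [yOdd, hR.bot, one_add_one_eq_two]
  rw [e1] at h3
  rw [e2] at h2
  generalize contFrac (fun α n => R α (n + 1)) r 1 = F' at *
  generalize contFracTail (fun α n => R α (n + 1)) r 1 = B at *
  generalize contFrac R r 1 = F at *
  generalize C (yOdd R 1) + contFracTail R r 1 = P at *
  generalize C (R 1 2 / R 1 1) = s at *
  have h4 : (1 + X * s * F') * (1 - X * P) = 1 := by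
    linear_combination (X * P) * h2 - X * F' * h3
  linear_combination (-F) * h4 + (1 + X * s * F') * h1

/-- `R` is quantified inside the induction because each coefficient is read off from the preceding
one of the shifted solution. -/
theorem IsQSystem.coeff_contFrac (n : ℕ) : ∀ {R : ℕ → ℤ → K}, IsQSystem r R → 1 ≤ r →
    (∀ α : ℕ, 1 ≤ α → α ≤ r → ∀ n : ℤ, 0 ≤ n → R α n ≠ 0) →
    coeff n (contFrac R r 1) = R 1 (n + 1) / R 1 1 := by
  induction n with
  | zero =>
    intro R hR hr h0
    rw [hR.contFrac_eq_shift h0, mul_assoc]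
    simp [div_self (h0 1 le_rfl hr 1 (by norm_num))]
  | succ n ih =>
    intro R hR hr h0
    have := ih hR.shift hr fun α h1 h2 n hn => h0 α h1 h2 (n + 1) (by omega)
    have h1 := h0 1 le_rfl hr 1 (by norm_num)
    have h2 := h0 1 le_rfl hr 2 (by norm_num)
    rw [hR.contFrac_eq_shift h0, mul_assoc, map_add, coeff_succ_X_mul, coeff_C_mul, this]
    rw [coeff_one, if_neg n.succ_ne_zero, zero_add, one_add_one_eq_two, Nat.cast_succ]
    field_simp

theorem isUnit_det_one_sub_compactTransferMatrix (r : ℕ) (R : ℕ → ℤ → K) :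
    IsUnit (1 - compactTransferMatrix r R).det := by
  -- At `t = 0` the matrix is lower triangular with unit diagonal.
  rw [PowerSeries.isUnit_iff_constantCoeff, RingHom.map_det, Matrix.det_of_isLowerTriangular]
  · simp [compactTransferMatrix]
  · intro i j hij
    have hij : i < j := hij
    have h1 : i ≠ j := hij.ne
    have h2 : (j : ℕ) ≠ i := fun h => h1 (Fin.ext h.symm)
    have h3 : (i : ℕ) ≠ j + 1 := by have : (i : ℕ) < j := hij; omega
    simp only [RingHom.mapMatrix_apply, Matrix.map_apply, Matrix.sub_apply, Matrix.one_apply,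
      if_neg h1, compactTransferMatrix, if_neg h2, if_neg h3]
    split_ifs <;> simp

theorem compactTransferMatrix_mulVec (r : ℕ) (R : ℕ → ℤ → K) (w : ℕ → PowerSeries K)
    (i : Fin (r + 1)) : (compactTransferMatrix r R).mulVec (fun j => w j) i =
      X * C (yOdd R (i + 1)) * w i +
        (if (i : ℕ) < r then X * C (yEven R (i + 1)) * w (i + 1) else 0) +
        (if 0 < (i : ℕ) then w (i - 1) else 0) := by
  obtain ⟨i, hi⟩ := i
  have h : ∀ j : Fin (r + 1), compactTransferMatrix r R ⟨i, hi⟩ j * w j =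
      (if (j : ℕ) = i then X * C (yOdd R (i + 1)) * w j else 0) +
      (if (j : ℕ) = i + 1 then X * C (yEven R (i + 1)) * w j else 0) +
      (if i = (j : ℕ) + 1 then w j else 0) := by
    intro j
    simp only [compactTransferMatrix]
    by_cases h1 : (j : ℕ) = i
    · simp [h1]
    by_cases h2 : (j : ℕ) = i + 1
    · simp [h2]; omega
    by_cases h3 : i = (j : ℕ) + 1
    · have : ¬(j : ℕ) = j + 1 + 1 := by omega
      simp [h3, this]
    · simp [h1, h2, h3]
  simp only [Matrix.mulVec, dotProduct, h]
  rw [Fin.sum_univ_eq_sum_range (fun j => (if j = i then X * C (yOdd R (i + 1)) * w j else 0) +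
      (if j = i + 1 then X * C (yEven R (i + 1)) * w j else 0) +
      (if i = j + 1 then w j else 0)), Finset.sum_add_distrib, Finset.sum_add_distrib,
    Finset.sum_ite_eq', Finset.sum_ite_eq', if_pos (Finset.mem_range.2 hi)]
  congr 1
  · congr 1
    exact if_congr (by simp) rfl rfl
  · cases i with
    | zero => simp
    | succ i =>
      simp only [Nat.add_right_cancel_iff, Finset.sum_ite_eq]
      rw [if_pos (Finset.mem_range.2 (by omega)), if_pos i.succ_pos, Nat.add_sub_cancel]

theorem inv_compactTransferMatrix_zero_zero (r : ℕ) (R : ℕ → ℤ → K) :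
    (1 - compactTransferMatrix r R)⁻¹ 0 0 = contFrac R r 1 := by
  -- The first column of the resolvent: a path reaching vertex `i + 1` contributes one continued
  -- fraction for each vertex up to it.
  let w : ℕ → PowerSeries K := fun i => ∏ j ∈ Finset.range (i + 1), contFrac R (r - j) (j + 1)
  have w_succ : ∀ i, w (i + 1) = w i * contFrac R (r - (i + 1)) (i + 1 + 1) :=
    fun i => Finset.prod_range_succ _ _
  have w_tail : ∀ i ≤ r, (if i < r then X * C (yEven R (i + 1)) * w (i + 1) else 0) =
      X * contFracTail R (r - i) (i + 1) * w i := by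
    intro i hi
    split_ifs with h
    · obtain ⟨k, hk⟩ : ∃ k, r - i = k + 1 := ⟨r - i - 1, by omega⟩
      have hk' : r - (i + 1) = k := by omega
      rw [w_succ, hk, hk', contFracTail]
      ring
    · rw [show r - i = 0 by omega, contFracTail, mul_zero, zero_mul]
  have hv : (1 - compactTransferMatrix r R).mulVec (fun j => w j) = Pi.single 0 1 := by
    ext1 i
    rw [Matrix.sub_mulVec, Matrix.one_mulVec, Pi.sub_apply, compactTransferMatrix_mulVec,
      w_tail i (by omega)]
    have h := contFrac_mul_denom R (r - i) (i + 1)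
    obtain ⟨i, hi⟩ := i
    cases i with
    | zero =>
      have hw : w 0 = contFrac R (r - 0) (0 + 1) := Finset.prod_range_one _
      simp only [lt_irrefl, if_false, Fin.zero_eta, Pi.single_eq_same, hw] at h ⊢
      linear_combination h
    | succ i =>
      have hne : (⟨i + 1, hi⟩ : Fin (r + 1)) ≠ 0 := by simp [Fin.ext_iff]
      rw [Pi.single_eq_of_ne hne]
      simp only [Nat.succ_pos, if_true, Nat.add_sub_cancel, w_succ] at h ⊢
      linear_combination w i * h
  have := congrArg (fun u => (1 - compactTransferMatrix r R)⁻¹.mulVec u 0) hv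
  simp only [Matrix.mulVec_mulVec,
    Matrix.nonsing_inv_mul _ (isUnit_det_one_sub_compactTransferMatrix r R),
    Matrix.one_mulVec, Matrix.mulVec_single_one, Matrix.col_apply] at this
  rw [← this]
  simp [w]

end ContinuedFraction

/-! ### Coefficient extraction and the explicit formula. -/

section Coefficients

open PowerSeries Finset

theorem stepCoeff_eq (a b c : ℕ) :
    stepCoeff a b c = (a + (b + c) - 1).choose (b + c) * (b + c).choose b := by
  rw [stepCoeff]
  split_ifs with h h'
  · simp [h, h'.1, h'.2]
  · rw [h, zero_add, Nat.choose_eq_zero_of_lt (by omega), zero_mul]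
  · obtain ⟨a, rfl⟩ := Nat.exists_eq_succ_of_ne_zero h
    rw [multinomialCoeff]
    have e1 : a + 1 + b + c - 1 = a + (b + c) := by omega
    have e2 : a + 1 + (b + c) - 1 = a + (b + c) := by omega
    have e3 : a + (b + c) - (a + b) = c := by omega
    simp only [Nat.succ_eq_add_one, e1, e2, Nat.add_sub_cancel, List.sum_cons, List.sum_nil,
      add_zero, List.map_cons, List.map_nil, List.prod_cons, List.prod_nil, mul_one, e3]
    rw [if_pos (by omega)]
    refine Nat.div_eq_of_eq_mul_left (by positivity) ?_
    have h1 := Nat.add_choose_mul_factorial_mul_factorial a (b + c)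
    have h2 := Nat.add_choose_mul_factorial_mul_factorial b c
    rw [← Nat.choose_symm_add] at h2
    rw [← h1, ← h2]
    ring

variable {K : Type*} [Field K]

/-- Negative binomial series for `(1 - X * V) ^ (-a)`, proved from `F = 1 + X * V * F` and Pascal's
rule. The spare factor `U` absorbs the `V` released at each step. For `a = 0` truncated subtraction
leaves only the term `x.1 = 0`. -/
theorem coeff_pow_mul_of_mul_one_sub_X_mul {F V : PowerSeries K} (hF : F * (1 - X * V) = 1)
    (n : ℕ) : ∀ (a : ℕ) (U : PowerSeries K), coeff n (F ^ a * U) =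
      ∑ x ∈ antidiagonal n, ((a + x.1 - 1).choose x.1 : K) * coeff x.2 (V ^ x.1 * U) := by
  have hF' : F = 1 + X * (V * F) := by linear_combination hF
  induction n with
  | zero =>
    intro a U
    have : constantCoeff F = 1 := by rw [hF']; simp
    simp [this]
  | succ n ihn =>
    intro a
    induction a with
    | zero =>
      intro U
      rw [Nat.sum_antidiagonal_succ]
      simp
    | succ a iha =>
      intro U
      have : F ^ (a + 1) * U = F ^ a * U + X * (F ^ (a + 1) * (V * U)) := by
        linear_combination F ^ a * U * hF'
      rw [this, map_add, coeff_succ_X_mul, iha, ihn, Nat.sum_antidiagonal_succ,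
        Nat.sum_antidiagonal_succ, add_assoc, ← sum_add_distrib]
      congr 1
      · simp
      · refine sum_congr rfl fun x _ => ?_
        have e1 : a + (x.1 + 1) - 1 = a + x.1 := by omega
        have e2 : a + 1 + x.1 - 1 = a + x.1 := by omega
        have e3 : a + 1 + (x.1 + 1) - 1 = a + x.1 + 1 := by omega
        rw [e1, e2, e3, Nat.choose_succ_succ, pow_succ V, mul_assoc]
        push_cast
        ring

theorem coeff_pow_of_mul_one_sub_X_mul {F G : PowerSeries K} {u v : K}
    (hF : F * (1 - X * (C u + C v * G)) = 1) (a n : ℕ) : coeff n (F ^ a) =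
      ∑ x ∈ antidiagonal n, ∑ y ∈ antidiagonal x.2,
        (stepCoeff a x.1 y.1 : K) * u ^ x.1 * v ^ y.1 * coeff y.2 (G ^ y.1) := by
  have := coeff_pow_mul_of_mul_one_sub_X_mul hF n a 1
  rw [mul_one] at this
  rw [this]
  trans ∑ x ∈ antidiagonal n, ∑ y ∈ antidiagonal x.1,
        (stepCoeff a y.1 y.2 : K) * u ^ y.1 * v ^ y.2 * coeff x.2 (G ^ y.2)
  · refine sum_congr rfl fun x _ => ?_
    rw [mul_one, (Commute.all _ _).add_pow', map_sum, mul_sum]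
    refine sum_congr rfl fun y hy => ?_
    rw [HasAntidiagonal.mem_antidiagonal] at hy
    rw [stepCoeff_eq, hy, map_nsmul, mul_pow, ← map_pow, ← map_pow, coeff_C_mul, coeff_C_mul,
      nsmul_eq_mul]
    push_cast
    ring
  · rw [sum_sigma', sum_sigma']
    -- Both sides sum over triples with total `n`: the exponent of `u`, the exponent of `v`, and the
    -- degree left for the power of `G`.
    refine sum_nbij' (fun x => ⟨(x.2.1, x.2.2 + x.1.2), (x.2.2, x.1.2)⟩)
      (fun x => ⟨(x.1.1 + x.2.1, x.2.2), (x.1.1, x.2.1)⟩) ?_ ?_ ?_ ?_ ?_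
    · rintro ⟨⟨i, j⟩, ⟨k, l⟩⟩ h
      simp only [mem_sigma, HasAntidiagonal.mem_antidiagonal, and_true] at h ⊢
      omega
    · rintro ⟨⟨i, j⟩, ⟨k, l⟩⟩ h
      simp only [mem_sigma, HasAntidiagonal.mem_antidiagonal, and_true] at h ⊢
      omega
    · rintro ⟨⟨i, j⟩, ⟨k, l⟩⟩ h
      simp only [mem_sigma, HasAntidiagonal.mem_antidiagonal] at h
      obtain ⟨-, rfl⟩ := h
      rfl
    · rintro ⟨⟨i, j⟩, ⟨k, l⟩⟩ h
      simp only [mem_sigma, HasAntidiagonal.mem_antidiagonal] at h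
      obtain ⟨-, rfl⟩ := h
      rfl
    · rintro ⟨⟨i, j⟩, ⟨k, l⟩⟩ _
      rfl

theorem sum_piAntidiag_insert {M : Type*} [AddCommMonoid M] {s : Finset ℕ} {i : ℕ} (hi : i ∉ s)
    (n : ℕ) (f : (ℕ → ℕ) → M) : ∑ p ∈ piAntidiag (insert i s) n, f p =
      ∑ x ∈ antidiagonal n, ∑ q ∈ piAntidiag s x.2, f (Function.update q i x.1) := by
  rw [← cons_eq_insert _ _ hi, piAntidiag_cons, sum_disjiUnion]
  refine sum_congr rfl fun x _ => ?_
  rw [sum_map]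
  refine sum_congr rfl fun q hq => ?_
  congr 1
  have hqi : q i = 0 := by
    by_contra h
    exact hi ((mem_piAntidiag.1 hq).2 i h)
  ext t
  by_cases h : t = i
  · subst h; simp [hqi]
  · simp [h]

/-- The contribution of `p` to the coefficients of the `a`-th power of `contFrac R k (β + 1)`. -/
noncomputable def contFracTerm (R : ℕ → ℤ → K) (p : ℕ → ℕ) : ℕ → ℕ → ℕ → K
  | 0, β, a => stepCoeff a (p (2 * β + 1)) 0 * yOdd R (β + 1) ^ p (2 * β + 1)
  | k + 1, β, a => stepCoeff a (p (2 * β + 1)) (p (2 * β + 2)) *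
      yOdd R (β + 1) ^ p (2 * β + 1) * yEven R (β + 1) ^ p (2 * β + 2) *
      contFracTerm R p k (β + 1) (p (2 * β + 2))

theorem contFracTerm_congr (R : ℕ → ℤ → K) {p q : ℕ → ℕ} (k : ℕ) : ∀ β a,
    (∀ i, 2 * β + 1 ≤ i → p i = q i) → contFracTerm R p k β a = contFracTerm R q k β a := by
  induction k with
  | zero => intro β a h; rw [contFracTerm, contFracTerm, h _ le_rfl]
  | succ k ih =>
    intro β a h
    rw [contFracTerm, contFracTerm, h _ le_rfl, h (2 * β + 2) (by omega),
      ih _ _ fun i hi => h i (by omega)]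

theorem coeff_contFrac_pow (R : ℕ → ℤ → K) (k : ℕ) : ∀ β a n,
    coeff n (contFrac R k (β + 1) ^ a) =
      ∑ p ∈ piAntidiag (Icc (2 * β + 1) (2 * (β + k) + 1)) n, contFracTerm R p k β a := by
  induction k with
  | zero =>
    intro β a n
    -- The last level is the general one with `v = 0` and `G = 0`, so only terms with zero
    -- `v`-exponent survive.
    have h : contFrac R 0 (β + 1) * (1 - X * (C (yOdd R (β + 1)) + C 0 * 0)) = 1 := by
      rw [mul_zero]
      exact contFrac_mul_denom R 0 (β + 1)
    rw [coeff_pow_of_mul_one_sub_X_mul h, add_zero, Icc_self, ← insert_empty_eq,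
      sum_piAntidiag_insert (notMem_empty _)]
    refine sum_congr rfl fun x _ => ?_
    rcases Nat.eq_zero_or_pos x.2 with h2 | h2
    · simp [h2, contFracTerm]
    · rw [piAntidiag_empty_of_ne_zero h2.ne', sum_empty]
      refine sum_eq_zero fun y hy => ?_
      rw [HasAntidiagonal.mem_antidiagonal] at hy
      rcases Nat.eq_zero_or_pos y.1 with h1 | h1
      · have : y.2 ≠ 0 := by omega
        simp [h1, coeff_one, this]
      · simp [h1.ne']
  | succ k ih =>
    intro β a n
    have e : Icc (2 * β + 1) (2 * (β + (k + 1)) + 1) =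
        insert (2 * β + 1) (insert (2 * β + 2) (Icc (2 * (β + 1) + 1) (2 * (β + 1 + k) + 1))) := by
      ext i
      simp only [mem_Icc, mem_insert]
      omega
    rw [coeff_pow_of_mul_one_sub_X_mul (contFrac_mul_denom R (k + 1) (β + 1)), e,
      sum_piAntidiag_insert (by simp only [mem_insert, mem_Icc]; omega)]
    refine sum_congr rfl fun x _ => ?_
    rw [sum_piAntidiag_insert (by simp only [mem_Icc]; omega)]
    refine sum_congr rfl fun y _ => ?_
    rw [ih, mul_sum]
    refine sum_congr rfl fun q _ => ?_
    rw [contFracTerm]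
    have e1 : Function.update (Function.update q (2 * β + 2) y.1) (2 * β + 1) x.1 (2 * β + 1) =
      x.1 := Function.update_self ..
    have e2 : Function.update (Function.update q (2 * β + 2) y.1) (2 * β + 1) x.1 (2 * β + 2) =
      y.1 := by rw [Function.update_of_ne (by omega), Function.update_self]
    rw [e1, e2]
    congr 1
    refine contFracTerm_congr _ _ _ _ fun i hi => ?_
    rw [Function.update_of_ne (by omega), Function.update_of_ne (by omega)]

theorem contFracTerm_eq_prod (R : ℕ → ℤ → K) {p : ℕ → ℕ} (k : ℕ) : ∀ β a,
    p (2 * (β + k) + 2) = 0 → contFracTerm R p k β a =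
      ((stepCoeff a (p (2 * β + 1)) (p (2 * β + 2)) * ∏ i ∈ range k,
        stepCoeff (p (2 * (β + i) + 2)) (p (2 * (β + i) + 3)) (p (2 * (β + i) + 4)) : ℕ) : K) *
      ((∏ i ∈ range k, yOdd R (β + i + 1) ^ p (2 * (β + i) + 1) *
        yEven R (β + i + 1) ^ p (2 * (β + i) + 2)) *
        yOdd R (β + k + 1) ^ p (2 * (β + k) + 1)) := by
  induction k with
  | zero =>
    intro β a h
    rw [add_zero] at h
    simp [contFracTerm, h]
  | succ k ih =>
    intro β a h
    have e : ∀ i, β + 1 + i = β + (i + 1) := fun i => by ring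
    rw [contFracTerm, ih (β + 1) _ (by rwa [e]), prod_range_succ', prod_range_succ']
    simp only [e, add_zero]
    have e3 : 2 * (β + 1) + 1 = 2 * β + 3 := by ring
    have e4 : 2 * (β + 1) + 2 = 2 * β + 4 := by ring
    rw [e3, e4]
    push_cast
    ring

theorem prod_Icc_one_eq_prod_range {M : Type*} [CommMonoid M] (f : ℕ → M) (r : ℕ) :
    ∏ i ∈ Icc 1 r, f i = ∏ i ∈ range r, f (i + 1) := by
  induction r with
  | zero => simp
  | succ r ih => rw [prod_Icc_succ_top (by omega), prod_range_succ, ih]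

/-- The last factor on the right is the boundary term of the truncation at `s`, which makes the
induction close. At `s = r` it becomes `1` once `R (r + 1) = 1` and `p (2 * r + 2) = 0`. -/
theorem IsQSystem.prod_weights_eq {r : ℕ} {R : ℕ → ℤ → K} (hR : IsQSystem r R)
    (h0 : ∀ α : ℕ, 1 ≤ α → α ≤ r → ∀ n : ℤ, 0 ≤ n → R α n ≠ 0) {p : ℕ → ℕ} (hp : p 0 = 0)
    (s : ℕ) : s ≤ r →
      (∏ i ∈ range s, yOdd R (i + 1) ^ p (2 * i + 1) * yEven R (i + 1) ^ p (2 * i + 2)) *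
        yOdd R (s + 1) ^ p (2 * s + 1) =
      (∏ i ∈ Icc 1 s,
        R i 0 ^ ((p (2 * i + 2) : ℤ) + p (2 * i + 1) - p (2 * i) - p (2 * i - 1)) /
        R i 1 ^ ((p (2 * i + 1) : ℤ) + p (2 * i) - p (2 * i - 1) - p (2 * i - 2))) *
        (R (s + 1) 1 ^ (p (2 * s + 1) + p (2 * s)) /
          (R s 0 ^ p (2 * s + 2) * R (s + 1) 0 ^ p (2 * s + 1))) := by
  induction s with
  | zero => intro _; simp [hp, yOdd, hR.bot, div_pow]
  | succ s ih =>
    intro hs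
    have a0 := hR.ne_zero h0 (show s ≤ r + 1 by omega) (n := 0) le_rfl
    have a1 := hR.ne_zero h0 (show s + 1 ≤ r + 1 by omega) (n := 0) le_rfl
    have a2 := hR.ne_zero h0 (show s + 2 ≤ r + 1 by omega) (n := 0) le_rfl
    have b1 := hR.ne_zero h0 (show s + 1 ≤ r + 1 by omega) (n := 1) (by norm_num)
    have b2 := hR.ne_zero h0 (show s + 2 ≤ r + 1 by omega) (n := 1) (by norm_num)
    rw [prod_range_succ, prod_Icc_succ_top (by omega), ← mul_assoc, ih (by omega), mul_assoc,
      mul_assoc, mul_assoc]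
    congr 1
    have e0 : 2 * (s + 1) = 2 * s + 2 := by ring
    have e1 : 2 * s + 2 - 1 = 2 * s + 1 := by omega
    have e2 : s + 2 - 1 = s + 1 := rfl
    simp only [e0, e1, e2, yOdd, yEven, Nat.add_sub_cancel, add_assoc, Nat.reduceAdd]
    rw [zpow_sub₀ a1, zpow_sub₀ a1, zpow_add₀ a1, zpow_sub₀ b1, zpow_sub₀ b1, zpow_add₀ b1]
    simp only [zpow_natCast, div_pow, mul_pow, pow_add]
    field_simp

end Coefficients

/-! ### Assembly. -/

theorem mainTheorem7 (r : ℕ) (hr : 1 ≤ r) :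
    -- with independent variables as seed, a solution exists and every solution is nowhere zero
    ((∃ R : ℕ → ℤ → SeedField r, IsQSystem r R ∧ HasGenericSeed r R) ∧
      ∀ R : ℕ → ℤ → SeedField r, IsQSystem r R → HasGenericSeed r R →
        ∀ α : ℕ, 1 ≤ α → α ≤ r → ∀ n : ℤ, R α n ≠ 0) ∧
    -- formulas for every solution in a field without zeros at times `n ≥ 0`
    ∀ (K : Type*) [Field K] (R : ℕ → ℤ → K), IsQSystem r R →
      (∀ α : ℕ, 1 ≤ α → α ≤ r → ∀ n : ℤ, 0 ≤ n → R α n ≠ 0) →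
      -- the generating function as a continued fraction and as a resolvent
      PowerSeries.mk (fun n : ℕ => R 1 (n : ℤ)) =
          PowerSeries.C (R 1 0) *
            (1 + PowerSeries.X * PowerSeries.C (yOdd R 1) * contFrac R r 1) ∧
      IsUnit (1 - compactTransferMatrix r R).det ∧
      PowerSeries.mk (fun n : ℕ => R 1 (n : ℤ)) =
          PowerSeries.C (R 1 0) *
            (1 + PowerSeries.X * PowerSeries.C (R 1 1 / R 1 0) *
              (1 - compactTransferMatrix r R)⁻¹ 0 0) ∧
      -- the explicit formula; `p` runs over the families with support in `{1, …, 2r+1}`, total `n`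
      ∀ n : ℕ,
        R 1 ((n : ℤ) + 1) =
          R 1 1 * ∑ p ∈ Finset.piAntidiag (Finset.Icc 1 (2 * r + 1)) n,
            (∏ i ∈ Finset.Icc 1 r,
              R i 0 ^ ((p (2 * i + 2) : ℤ) + p (2 * i + 1) - p (2 * i) - p (2 * i - 1)) /
              R i 1 ^ ((p (2 * i + 1) : ℤ) + p (2 * i) - p (2 * i - 1) - p (2 * i - 2))) *
            (((p 1 + p 2).choose (p 1) *
              ∏ l ∈ Finset.Icc 1 r,
                stepCoeff (p (2 * l)) (p (2 * l + 1)) (p (2 * l + 2)) : ℕ) : K) := by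
  refine ⟨⟨exists_isQSystem_hasGenericSeed r, fun R hR hs α _ h2 n =>
    ((hR.positiveAtOne hs n).1 α (by omega)).ne_zero⟩, ?_⟩
  intro K _ R hR h0
  have n0 := h0 1 le_rfl hr 0 le_rfl
  have n1 := h0 1 le_rfl hr 1 (by norm_num)
  have y1 : yOdd R 1 = R 1 1 / R 1 0 := by simp [yOdd, hR.bot]
  have gen : PowerSeries.mk (fun n : ℕ => R 1 (n : ℤ)) = PowerSeries.C (R 1 0) *
      (1 + PowerSeries.X * PowerSeries.C (yOdd R 1) * contFrac R r 1) := by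
    ext n
    rw [PowerSeries.coeff_mk, PowerSeries.coeff_C_mul, mul_assoc]
    cases n with
    | zero => simp
    | succ n =>
      rw [map_add, PowerSeries.coeff_succ_X_mul, PowerSeries.coeff_C_mul,
        hR.coeff_contFrac n hr h0, PowerSeries.coeff_one, if_neg n.succ_ne_zero, y1,
        Nat.cast_succ]
      field_simp
      ring
  refine ⟨gen, isUnit_det_one_sub_compactTransferMatrix r R, ?_, fun n => ?_⟩
  · rw [gen, inv_compactTransferMatrix_zero_zero, y1]
  -- Taking `a = 1` turns the first `stepCoeff` into the ordinary binomial `(p 1 + p 2).choose (p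
  -- 1)`.
  · have h := coeff_contFrac_pow R r 0 1 n
    rw [pow_one, zero_add, hR.coeff_contFrac n hr h0, div_eq_iff n1, mul_comm] at h
    rw [h]
    simp only [mul_zero, zero_add]
    congr 1
    refine Finset.sum_congr rfl fun p hp => ?_
    have supp : ∀ i, i ∉ Finset.Icc 1 (2 * r + 1) → p i = 0 := fun i hi => by
      by_contra h
      exact hi ((Finset.mem_piAntidiag.1 hp).2 i h)
    have p0 : p 0 = 0 := supp _ (by simp)
    have pr : p (2 * r + 2) = 0 := supp _ (by simp)
    rw [contFracTerm_eq_prod R r 0 1 (by rwa [zero_add]), mul_comm]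
    simp only [zero_add, mul_zero]
    rw [hR.prod_weights_eq h0 p0 r le_rfl, pr, hR.top, hR.top, prod_Icc_one_eq_prod_range
      (fun l => stepCoeff (p (2 * l)) (p (2 * l + 1)) (p (2 * l + 2))), stepCoeff_eq]
    simp [mul_add]
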